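/- **Theorem.** Let $V,H,C,G$ be pairwise disjoint finite sets of (visible input, hidden input, controlled output, guided output) signals, $I=V\cup H$, $O=C\cup G$, let $M$ be a finite set of memories with initial memory $m_0\in M$, and let $\mathcal P_{M,H,G}$ be the set of programs $p:M\times 2^H\to M\times 2^G$. For a $(2^C\times\mathcal P_{M,H,G})$-edge-labeled tree $T=\langle (2^V)^*,\ell\rangle$, where $\ell(x,x\cdot v)$ is the label of the edge from $x$ to $x\cdot v$, the induced computation tree $\mathrm{full}(T)=\langle (2^I)^*,\kappa\rangle$ is the $2^{I\cup O}$-node-labeled tree defined, together with a memory labeling $\kappa_M:(2^I)^*\to M$, by $\kappa(\varepsilon)=\emptyset$, $\kappa_M(\varepsilon)=m_0$, and, for $w=(v_1\cup h_1)\cdots(v_k\cup h_k)$ with $v_j\in 2^V$, $h_j\in 2^H$, and for $v\in 2^V$, $h\in 2^H$: if $\ell(v_1\cdots v_k,\;v_1\cdots v_k\cdot v)=\langle c,p\rangle$ and $p(\kappa_M(w),h)=\langle m,g\rangle$, then $\kappa(w\cdot(v\cup h))=v\cup h\cup c\cup g$ and $\kappa_M(w\cdot(v\cup h))=m$. An alternating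 parity tree automaton (APT) over $\Sigma$-node-labeled $\Upsilon$-trees has a finite state set $Q$, an initial state, a transition function from $Q\times\Sigma$ to the positive Boolean formulas over $\Upsilon\times Q$, and a priority function $\alpha:Q\to\mathbb N$. It accepts a tree if it has a run on it such that, on each infinite path of the run, the highest priority visited infinitely often is even. Its size is the number of its states, and its index is the number of priorities that it uses. An APT reads an edge-labeled tree $T$ as above as a node-labeled tree, by pushing the label of each edge downward to the target node of the edge; the root gets the label $\langle\emptyset,p_0\rangle$, where $p_0(m,h)=\langle m_0,\emptyset\rangle$ for all $m\in M$ and $h\in 2^H$. Then for every APT $\mathcal A$ over $2^{I\cup O}$-node-labeled $2^I$-trees there is an APT $\mathcal U$ over $(2^C\times\mathcal P_{M,H,G})$-edge-labeled $2^V$-trees, of size exactly $|\mathcal A|\cdot|M|\cdot 2^{|I|}$ and with the same set of priorities as $\mathcal A$ (in particular, of the same index), such that for every $(2^C\times\mathcal P_{M,H,G})$-edge-labeled tree $T=\langle(2^V)^*,\ell\rangle$, $\mathcal U$ accepts $T$ if and only if $\mathcal A$ accepts $\mathrm{full}(T)$. -/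

import Mathlib

universe u

namespace SGE

/-! ### Trees -/

/-- Nodes of the full `Dir`-tree, i.e. finite words over the set `Dir` of directions. A word is
stored with its last letter first: the root is `[]`, and the successor `x · a` of the node `x` in
direction `a` is `a :: x`. -/
abbrev Node (Dir : Type u) : Type u := List Dir

/-- The labeling `κ` of a `Lab`-node-labeled full `Dir`-tree. -/
abbrev NodeLabeling (Lab Dir : Type u) : Type u := Node Dir → Lab

/-- The labeling `ℓ` of a `Lab`-edge-labeled full `Dir`-tree: `ℓ x a` is the label of the edge
from `x` to `x · a`. -/
abbrev EdgeLabeling (Lab Dir : Type u) : Type u := Node Dir → Dir → Lab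

/-- An edge-labeled tree viewed as a node-labeled one: labels are pushed downward to the target
node of the edge, and the root gets the label `root`. -/
def pushDown {Lab Dir : Type u} (root : Lab) (ℓ : EdgeLabeling Lab Dir) : NodeLabeling Lab Dir
  | [] => root
  | a :: x => ℓ x a

/-! ### Alternating parity tree automata -/

/-- Positive Boolean formulas over the set `X` of atoms. -/
inductive PosBool (X : Type u) : Type u
  | tru : PosBool X
  | fls : PosBool X
  | atom : X → PosBool X
  | and : PosBool X → PosBool X → PosBool X
  | or : PosBool X → PosBool X → PosBool X

/-- `θ.Sat S`: assigning true to the atoms in `S` and false to all other atoms satisfies `θ`. -/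
def PosBool.Sat {X : Type u} (S : Set X) : PosBool X → Prop
  | .tru => True
  | .fls => False
  | .atom x => x ∈ S
  | .and θ₁ θ₂ => θ₁.Sat S ∧ θ₂.Sat S
  | .or θ₁ θ₂ => θ₁.Sat S ∨ θ₂.Sat S

/-- An alternating parity tree automaton with labels in `Lab` and directions in `Dir`. -/
structure APT (Lab Dir : Type u) : Type (u + 1) where
  /-- the states -/
  Q : Type u
  finite_Q : Finite Q
  /-- the initial state -/
  init : Q
  /-- the transition function -/
  trans : Q → Lab → PosBool (Dir × Q)
  /-- the parity condition, giving each state its priority -/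
  prio : Q → ℕ

namespace APT

variable {Lab Dir : Type u}

/-- The size of an automaton: its number of states. -/
noncomputable def size (A : APT Lab Dir) : ℕ := Nat.card A.Q

/-- The index of an automaton: the number of priorities that it uses. -/
noncomputable def index (A : APT Lab Dir) : ℕ := (Set.range A.prio).ncard

/-- A run of `A` on the node-labeled tree `κ`: a tree with directions in `Dir × Q` whose nodes are
labeled by pairs of a node of the input tree and a state. A node `y` labeled `(x, q)` has as
children exactly the nodes `y · (a, q')`, labeled `(x · a, q')`, for `(a, q')` in some (possibly
empty) set `S` that satisfies the formula given by the transition function at `q` and `κ x`. -/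
structure Run (A : APT Lab Dir) (κ : NodeLabeling Lab Dir) where
  /-- the nodes of the run tree -/
  tree : Set (Node (Dir × A.Q))
  /-- the labeling of the run tree (only its values on `tree` matter) -/
  label : Node (Dir × A.Q) → Node Dir × A.Q
  root_mem : [] ∈ tree
  parent_mem : ∀ y d, d :: y ∈ tree → y ∈ tree
  label_root : label [] = ([], A.init)
  branch : ∀ y ∈ tree, ∃ S : Set (Dir × A.Q),
    (A.trans (label y).2 (κ (label y).1)).Sat S ∧
    (∀ d, d :: y ∈ tree ↔ d ∈ S) ∧
    (∀ d ∈ S, label (d :: y) = (d.1 :: (label y).1, d.2))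

/-- `π 0, π 1, π 2, …` is an infinite path of the run tree, starting at its root. -/
def Run.IsPath {A : APT Lab Dir} {κ : NodeLabeling Lab Dir} (r : A.Run κ)
    (π : ℕ → Node (Dir × A.Q)) : Prop :=
  π 0 = [] ∧ ∀ n, π n ∈ r.tree ∧ ∃ d, π (n + 1) = d :: π n

/-- The set of states that the run visits infinitely often along `π`. -/
def Run.infStates {A : APT Lab Dir} {κ : NodeLabeling Lab Dir} (r : A.Run κ)
    (π : ℕ → Node (Dir × A.Q)) : Set A.Q :=
  {q | {n | (r.label (π n)).2 = q}.Infinite}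

/-- A run is accepting if on each of its infinite paths the highest priority of a state visited
infinitely often is even. -/
def Run.IsAccepting {A : APT Lab Dir} {κ : NodeLabeling Lab Dir} (r : A.Run κ) : Prop :=
  ∀ π, r.IsPath π → ∃ k, IsGreatest (A.prio '' r.infStates π) k ∧ Even k

/-- `A` accepts the node-labeled tree `κ`. -/
def Accepts (A : APT Lab Dir) (κ : NodeLabeling Lab Dir) : Prop :=
  ∃ r : A.Run κ, r.IsAccepting

end APT

/-! ### Programs and induced computation trees

Assignments to a finite set `X` of signals, i.e. the elements of `2^X`, are terms of `Finset X`.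
The input signals are `I = V ⊕ H` (visible and hidden), the output signals are `O = C ⊕ G`
(controlled and guided). -/

section

variable {V H C G M : Type u}

/-- Propositional programs: functions from `M × 2^H` to `M × 2^G`. -/
abbrev Prog (M H G : Type u) : Type u := M × Finset H → M × Finset G

/-- The projection of a node of the full `2^I`-tree to the full `2^V`-tree, which removes the
hidden signals from all the input assignments. -/
def visible : Node (Finset (V ⊕ H)) → Node (Finset V) := List.map Finset.toLeft

/-- The memory labeling `κ_M` of the full `2^I`-tree: `memory m₀ ℓ w` is the memory of the
environment after the history `w`, where `m₀` is its initial memory. -/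
def memory (m₀ : M) (ℓ : EdgeLabeling (Finset C × Prog M H G) (Finset V)) :
    Node (Finset (V ⊕ H)) → M
  | [] => m₀
  | i :: w => ((ℓ (visible w) i.toLeft).2 (memory m₀ ℓ w, i.toRight)).1

/-- The labeling `κ` of the computation tree `full(T)` induced by the tree `T` with labeling `ℓ`:
the root is labeled by `∅`, and `w · (v ∪ h)` by `v ∪ h ∪ c ∪ g`, where `(c, p)` is the label of
the corresponding edge of `T` and `g` is what the program `p` assigns to the guided signals. -/
def full (m₀ : M) (ℓ : EdgeLabeling (Finset C × Prog M H G) (Finset V)) :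
    NodeLabeling (Finset ((V ⊕ H) ⊕ (C ⊕ G))) (Finset (V ⊕ H))
  | [] => ∅
  | i :: w =>
    let c : Finset C := (ℓ (visible w) i.toLeft).1
    let p : Prog M H G := (ℓ (visible w) i.toLeft).2
    let g : Finset G := (p (memory m₀ ℓ w, i.toRight)).2
    i.disjSum (c.disjSum g)

/-- The label `(∅, p₀)` that the root gets when labels are pushed downward: no controlled signal
holds, and `p₀` sets the memory to `m₀` and assigns `∅` to the guided signals. -/
def rootLabel (m₀ : M) : Finset C × Prog M H G := (∅, fun _ => (m₀, ∅))

/-- Acceptance of a `(2^C × Prog)`-edge-labeled `2^V`-tree: the automaton reads the tree with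
labels pushed downward to the target nodes of the edges, and `rootLabel m₀` at the root. -/
def APT.AcceptsEdgeLabeled (U : APT (Finset C × Prog M H G) (Finset V)) (m₀ : M)
    (ℓ : EdgeLabeling (Finset C × Prog M H G) (Finset V)) : Prop :=
  U.Accepts (pushDown (rootLabel m₀) ℓ)

end

end SGE

namespace SGE

/-! The automaton `guide` runs on the `2^V`-tree and keeps in its state what that tree hides: the
last full input and the memory before it. As labels are pushed downward, the edge label read at a
node, with this data, yields both the label of the computation tree and the new memory. Alternation
sends separate copies in the same visible direction for inputs that differ only in hidden signals.
Nodes of runs correspond under `lift`, with left inverse `unlift`. Transitions match by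
`trans_stateAt_lift` and priorities by `infPrios_lift`, so accepting runs transfer both ways. -/

/-- Renaming the atoms of a positive Boolean formula. -/
def PosBool.map {X Y : Type u} (f : X → Y) : PosBool X → PosBool Y
  | .tru => .tru
  | .fls => .fls
  | .atom x => .atom (f x)
  | .and θ₁ θ₂ => .and (θ₁.map f) (θ₂.map f)
  | .or θ₁ θ₂ => .or (θ₁.map f) (θ₂.map f)

theorem PosBool.sat_map {X Y : Type u} (f : X → Y) (S : Set Y) (θ : PosBool X) :
    (θ.map f).Sat S ↔ θ.Sat (f ⁻¹' S) := by
  induction θ with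
  | tru => rfl
  | fls => rfl
  | atom x => rfl
  | and θ₁ θ₂ ih₁ ih₂ => exact and_congr ih₁ ih₂
  | or θ₁ θ₂ ih₁ ih₂ => exact or_congr ih₁ ih₂

namespace APT

/-! ### Labels and priorities along runs -/

section Runs

variable {Lab Dir : Type u} {A : APT Lab Dir} {κ : NodeLabeling Lab Dir}

/-- The state in which every run visits a node `y` of its run tree. -/
def stateAt (A : APT Lab Dir) : Node (Dir × A.Q) → A.Q
  | [] => A.init
  | d :: _ => d.2

/-- The label of a node of a run tree is determined by the node. -/
theorem Run.label_eq (r : A.Run κ) (y : Node (Dir × A.Q)) (hy : y ∈ r.tree) :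
    r.label y = (y.map Prod.fst, A.stateAt y) := by
  induction y with
  | nil => exact r.label_root
  | cons d y ih =>
    have hy' := r.parent_mem y d hy
    obtain ⟨S, -, hS, hl⟩ := r.branch y hy'
    rw [hl d ((hS d).1 hy), ih hy']
    rfl

/-- The priorities that a sequence of nodes of a run tree visits infinitely often. -/
def infPrios (A : APT Lab Dir) (π : ℕ → Node (Dir × A.Q)) : Set ℕ :=
  {k | {n | A.prio (A.stateAt (π n)) = k}.Infinite}

/-- With finitely many states, a priority that recurs is the priority of some recurring state.
Acceptance can thus be compared between automata with different states. -/
theorem Run.prio_image_infStates (r : A.Run κ) {π : ℕ → Node (Dir × A.Q)} (hπ : r.IsPath π) :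
    A.prio '' r.infStates π = A.infPrios π := by
  have hl (n : ℕ) : (r.label (π n)).2 = A.stateAt (π n) := by
    rw [r.label_eq _ (hπ.2 n).1]
  ext k
  simp only [Set.mem_image, infStates, infPrios, Set.mem_ofPred_eq, hl]
  constructor
  · rintro ⟨q, hq, rfl⟩
    exact hq.mono fun n hn => congrArg A.prio hn
  · intro hk
    have := A.finite_Q
    by_contra! hfin
    refine hk (((Set.toFinite {q | A.prio q = k}).biUnion
      (t := fun q => {n | A.stateAt (π n) = q})
      fun q hq => ?_).subset fun n hn => ?_)
    · by_contra hinf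
      exact hfin q hinf hq
    · exact Set.mem_biUnion (x := A.stateAt (π n)) hn rfl

theorem Run.isAccepting_iff (r : A.Run κ) :
    r.IsAccepting ↔ ∀ π, r.IsPath π → ∃ k, IsGreatest (A.infPrios π) k ∧ Even k :=
  forall₂_congr fun π hπ => by rw [r.prio_image_infStates hπ]

end Runs

/-! ### The simulating automaton -/

section Full

variable {V H C G M : Type u}

/-- The atom of the guiding automaton that simulates the atom `d`, when the memory is `m`. -/
def guideAtom {Q : Type u} (m : M) (d : Finset (V ⊕ H) × Q) :
    Finset V × (Q × M × Finset (V ⊕ H)) :=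
  (d.1.toLeft, (d.2, m, d.1))

/-- The visible direction forgets hidden signals, but the target state stores the whole input. -/
theorem guideAtom_injective {Q : Type u} (m : M) :
    Function.Injective (guideAtom (V := V) (H := H) (Q := Q) m) := by
  rintro ⟨i, q⟩ ⟨i', q'⟩ h
  simp only [guideAtom, Prod.mk.injEq] at h
  simp [h]

variable [Finite V] [Finite H] [Finite M]

/-- The automaton that simulates `A` on the computation tree while reading the edge-labeled tree.
In addition to the state of `A` it stores the memory before the last step and the last input. -/
abbrev guide (m₀ : M) (A : APT (Finset ((V ⊕ H) ⊕ (C ⊕ G))) (Finset (V ⊕ H))) :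
    APT (Finset C × Prog M H G) (Finset V) where
  Q := A.Q × M × Finset (V ⊕ H)
  finite_Q := by have := A.finite_Q; infer_instance
  init := (A.init, m₀, ∅)
  trans s lab :=
    (A.trans s.1 (s.2.2.disjSum (lab.1.disjSum (lab.2 (s.2.1, s.2.2.toRight)).2))).map
      (guideAtom (lab.2 (s.2.1, s.2.2.toRight)).1)
  prio s := A.prio s.1

variable (m₀ : M) (A : APT (Finset ((V ⊕ H) ⊕ (C ⊕ G))) (Finset (V ⊕ H)))
  (ℓ : EdgeLabeling (Finset C × Prog M H G) (Finset V))

theorem size_guide : (guide m₀ A).size = A.size * Nat.card M * 2 ^ Nat.card (V ⊕ H) := by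
  have := Fintype.ofFinite (V ⊕ H)
  change Nat.card (A.Q × M × Finset (V ⊕ H)) = _
  simp only [Nat.card_prod, size, mul_assoc]
  rw [Nat.card_eq_fintype_card (α := Finset (V ⊕ H)), Fintype.card_finset,
    Nat.card_eq_fintype_card (α := V ⊕ H)]

theorem range_prio_guide : Set.range (guide m₀ A).prio = Set.range A.prio := by
  ext k
  constructor
  · rintro ⟨s, rfl⟩
    exact ⟨s.1, rfl⟩
  · rintro ⟨q, rfl⟩
    exact ⟨(q, m₀, ∅), rfl⟩

/-- The node of the run tree of `guide m₀ A` that simulates a node of a run tree of `A`. -/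
def lift : Node (Finset (V ⊕ H) × A.Q) → Node (Finset V × (guide m₀ A).Q)
  | [] => []
  | d :: y => guideAtom (memory m₀ ℓ (y.map Prod.fst)) d :: lift y

/-- The node of the run tree of `A` that a node of a run tree of `guide m₀ A` simulates. -/
def unlift : Node (Finset V × (guide m₀ A).Q) → Node (Finset (V ⊕ H) × A.Q) :=
  List.map fun d => (d.2.2.2, d.2.1)

theorem unlift_lift (y : Node (Finset (V ⊕ H) × A.Q)) : unlift m₀ A (lift m₀ A ℓ y) = y := by
  induction y with
  | nil => rfl
  | cons d y ih => exact congrArg (d :: ·) ih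

theorem map_fst_lift (y : Node (Finset (V ⊕ H) × A.Q)) :
    (lift m₀ A ℓ y).map Prod.fst = visible (y.map Prod.fst) := by
  induction y with
  | nil => rfl
  | cons d y ih => exact congrArg (d.1.toLeft :: ·) ih

theorem prio_stateAt_lift (y : Node (Finset (V ⊕ H) × A.Q)) :
    (guide m₀ A).prio ((guide m₀ A).stateAt (lift m₀ A ℓ y)) = A.prio (A.stateAt y) := by
  cases y <;> rfl

theorem infPrios_lift (π : ℕ → Node (Finset (V ⊕ H) × A.Q)) :
    (guide m₀ A).infPrios (fun n => lift m₀ A ℓ (π n)) = A.infPrios π := by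
  ext k
  exact iff_of_eq (congrArg Set.Infinite
    (Set.ext fun n => by
      change (guide m₀ A).prio _ = k ↔ _
      rw [prio_stateAt_lift]
      rfl))

/-- The heart of the simulation: below the root, both sides unfold to the same formula. -/
theorem trans_stateAt_lift (y : Node (Finset (V ⊕ H) × A.Q)) :
    (guide m₀ A).trans ((guide m₀ A).stateAt (lift m₀ A ℓ y))
        (pushDown (rootLabel m₀) ℓ ((lift m₀ A ℓ y).map Prod.fst)) =
      (A.trans (A.stateAt y) (full m₀ ℓ (y.map Prod.fst))).map
        (guideAtom (memory m₀ ℓ (y.map Prod.fst))) := by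
  rw [map_fst_lift]
  cases y with
  | nil =>
    -- At the root, the stored input `∅` and `rootLabel` produce the label `∅` and the memory `m₀`.
    change (A.trans A.init ((∅ : Finset (V ⊕ H)).disjSum
      ((∅ : Finset C).disjSum (∅ : Finset G)))).map (guideAtom m₀) = _
    simp only [Finset.empty_disjSum, Finset.map_empty]
    rfl
  | cons d y => rfl

/-! ### Translating runs -/

variable {m₀ A ℓ}

/-- The run of `guide m₀ A` that simulates a run of `A` on the computation tree. -/
def Run.lift (r : A.Run (full m₀ ℓ)) : (guide m₀ A).Run (pushDown (rootLabel m₀) ℓ) where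
  tree := APT.lift m₀ A ℓ '' r.tree
  label y := (y.map Prod.fst, (guide m₀ A).stateAt y)
  root_mem := ⟨[], r.root_mem, rfl⟩
  parent_mem := by
    rintro y d ⟨_ | ⟨e, z⟩, hz, h⟩
    · cases h
    · exact ⟨z, r.parent_mem z e hz, (List.cons.inj h).2⟩
  label_root := rfl
  branch := by
    rintro _ ⟨z, hz, rfl⟩
    obtain ⟨S, hS, hc, -⟩ := r.branch z hz
    refine ⟨guideAtom (memory m₀ ℓ (z.map Prod.fst)) '' S, ?_, fun d => ?_, fun _ _ => rfl⟩
    · rw [trans_stateAt_lift, PosBool.sat_map, (guideAtom_injective _).preimage_image]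
      rwa [r.label_eq z hz] at hS
    · constructor
      · rintro ⟨_ | ⟨e, z'⟩, hz', h⟩
        · cases h
        · obtain ⟨h₁, h₂⟩ := List.cons.inj h
          -- Distinct nodes have distinct lifts, so no children are added.
          obtain rfl : z' = z := by
            simpa only [unlift_lift] using congrArg (unlift m₀ A) h₂
          exact ⟨e, (hc e).1 hz', h₁⟩
      · rintro ⟨e, he, rfl⟩
        exact ⟨e :: z, (hc e).2 he, rfl⟩

theorem Run.isAccepting_lift {r : A.Run (full m₀ ℓ)} (hr : r.IsAccepting) :
    r.lift.IsAccepting := by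
  rw [isAccepting_iff] at hr ⊢
  rintro π ⟨h₀, hπ⟩
  -- The preimages `ρ n` are chosen separately; the left inverse `unlift` shows that they form a
  -- path.
  choose ρ hρ hρπ using fun n => (hπ n).1
  obtain rfl : (fun n => APT.lift m₀ A ℓ (ρ n)) = π := funext hρπ
  have hu (n : ℕ) : unlift m₀ A (APT.lift m₀ A ℓ (ρ n)) = ρ n := unlift_lift ..
  rw [infPrios_lift]
  refine hr ρ ⟨?_, fun n => ⟨hρ n, ?_⟩⟩
  · rw [← hu 0]
    exact congrArg (unlift m₀ A) h₀
  · obtain ⟨d, hd⟩ := (hπ n).2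
    refine ⟨(d.2.2.2, d.2.1), ?_⟩
    rw [← hu (n + 1), ← hu n]
    exact congrArg (unlift m₀ A) hd

/-- The run of `A` on the computation tree that is simulated by a run of `guide m₀ A`. -/
def Run.unlift (r : (guide m₀ A).Run (pushDown (rootLabel m₀) ℓ)) : A.Run (full m₀ ℓ) where
  tree := APT.lift m₀ A ℓ ⁻¹' r.tree
  label y := (y.map Prod.fst, A.stateAt y)
  root_mem := r.root_mem
  parent_mem _ _ h := r.parent_mem _ _ h
  label_root := rfl
  branch := by
    intro y hy
    obtain ⟨S, hS, hc, -⟩ := r.branch _ hy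
    -- `S` may contain atoms outside the range of `guideAtom`; the renamed formula does not mention
    -- them, so they can be dropped.
    refine ⟨guideAtom (memory m₀ ℓ (y.map Prod.fst)) ⁻¹' S, ?_, fun d => hc _, fun _ _ => rfl⟩
    rwa [r.label_eq _ hy, trans_stateAt_lift, PosBool.sat_map] at hS

theorem Run.isAccepting_unlift {r : (guide m₀ A).Run (pushDown (rootLabel m₀) ℓ)}
    (hr : r.IsAccepting) : r.unlift.IsAccepting := by
  rw [isAccepting_iff] at hr ⊢
  rintro π ⟨h₀, hπ⟩
  rw [← infPrios_lift m₀ A ℓ]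
  refine hr _ ⟨congrArg (APT.lift m₀ A ℓ) h₀, fun n => ⟨(hπ n).1, ?_⟩⟩
  obtain ⟨d, hd⟩ := (hπ n).2
  exact ⟨guideAtom (memory m₀ ℓ ((π n).map Prod.fst)) d, congrArg (APT.lift m₀ A ℓ) hd⟩

theorem acceptsEdgeLabeled_guide_iff :
    (guide m₀ A).AcceptsEdgeLabeled m₀ ℓ ↔ A.Accepts (full m₀ ℓ) :=
  ⟨fun ⟨r, hr⟩ => ⟨r.unlift, Run.isAccepting_unlift hr⟩,
    fun ⟨r, hr⟩ => ⟨r.lift, Run.isAccepting_lift hr⟩⟩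

end Full

end APT

end SGE

theorem mainTheorem6 {V H C G M : Type u} [Finite V] [Finite H] [Finite C] [Finite G] [Finite M]
    (m₀ : M) (A : SGE.APT (Finset ((V ⊕ H) ⊕ (C ⊕ G))) (Finset (V ⊕ H))) :
    ∃ U : SGE.APT (Finset C × SGE.Prog M H G) (Finset V),
      U.size = A.size * Nat.card M * 2 ^ Nat.card (V ⊕ H) ∧
      Set.range U.prio = Set.range A.prio ∧
      U.index = A.index ∧
      ∀ ℓ : SGE.EdgeLabeling (Finset C × SGE.Prog M H G) (Finset V),
        U.AcceptsEdgeLabeled m₀ ℓ ↔ A.Accepts (SGE.full m₀ ℓ) := by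
  have h := SGE.APT.range_prio_guide m₀ A
  exact ⟨SGE.APT.guide m₀ A, SGE.APT.size_guide m₀ A, h, congrArg Set.ncard h,
    fun _ => SGE.APT.acceptsEdgeLabeled_guide_iff⟩
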